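/- Let $F$ be a field of characteristic $2$. For $\alpha\in F$ and $\beta\in F^\times$ let $[\alpha,\beta)$ denote the quaternion $F$-algebra generated by $i,j$ subject to $i^2+i=\alpha$, $j^2=\beta$, $ij+ji=j$. Let $A$ be a biquaternion division algebra over $F$, i.e. a division algebra isomorphic to $[\alpha,\beta)\otimes_F[\gamma,\delta)$ for some $\alpha,\gamma\in F$ and $\beta,\delta\in F^\times$. A quadruple of generators of $A$ is a quadruple $(x,y,z,u)$ of elements that generate $A$ as an $F$-algebra and satisfy $$x^2+x\in F,\quad y^2\in F^\times,\quad z^2+z\in F,\quad u^2\in F^\times,$$ $$xy+yx=y,\quad zu+uz=u,\quad xz=zx,\quad xu=ux,\quad yz=zy,\quad yu=uy.$$ The order of the two pairs $(x,y)$ and $(z,u)$ is disregarded, i.e. $(x,y,z,u)$ and $(z,u,x,y)$ are regarded as the same quadruple. A step of type $\Lambda_3$ passes from one quadruple of generators of $A$ to another by changing at most three of the four generators; that is, with the pairs of both quadruples suitably ordered, the two quadruples agree in at least one of the four positions. Then any two quadruples of generators of $A$ are connected by a chain of at most three steps of type $\Lambda_3$. -/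

import Mathlib

/-!
Biquaternion algebras in characteristic two, their quadruples of standard generators, and chains of
steps that change at most three generators.
-/

open scoped TensorProduct

/-- The quaternion symbol algebra `[α, β) = F⟨i, j : i² + i = α, j² = β, i j + j i = j⟩` over a field
of characteristic two. (In `QuaternionAlgebra F a b c` one has `i² = a + b i`, `j² = c` and
`j i = b j - i j`.) -/
abbrev SymbolAlgebra (F : Type*) [Field F] (α β : F) : Type _ :=
  QuaternionAlgebra F α 1 β

/-- `A` is a biquaternion algebra over the field `F` of characteristic two: it is isomorphic to a
tensor product `[α, β) ⊗ [γ, δ)` of two quaternion algebras. -/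
def IsBiquaternionAlgebra (F A : Type*) [Field F] [Ring A] [Algebra F A] : Prop :=
  ∃ α β γ δ : F, β ≠ 0 ∧ δ ≠ 0 ∧
    Nonempty (A ≃ₐ[F] (SymbolAlgebra F α β ⊗[F] SymbolAlgebra F γ δ))

/-- An (ordered) quadruple `(x, y, z, u)` of standard generators of the `F`-algebra `A`. -/
structure GenQuadruple (F A : Type*) [Field F] [Ring A] [Algebra F A] where
  x : A
  y : A
  z : A
  u : A
  x_artinSchreier : ∃ α : F, x ^ 2 + x = algebraMap F A α
  y_sq : ∃ β : F, β ≠ 0 ∧ y ^ 2 = algebraMap F A β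
  z_artinSchreier : ∃ γ : F, z ^ 2 + z = algebraMap F A γ
  u_sq : ∃ δ : F, δ ≠ 0 ∧ u ^ 2 = algebraMap F A δ
  xy : x * y + y * x = y
  zu : z * u + u * z = u
  xz : x * z = z * x
  xu : x * u = u * x
  yz : y * z = z * y
  yu : y * u = u * y
  generate : Algebra.adjoin F ({x, y, z, u} : Set A) = ⊤

namespace GenQuadruple

variable {F A : Type*} [Field F] [Ring A] [Algebra F A]

/-- Interchanging the two pairs: `(x, y, z, u) ↦ (z, u, x, y)`. -/
def swap (p : GenQuadruple F A) : GenQuadruple F A where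
  x := p.z
  y := p.u
  z := p.x
  u := p.y
  x_artinSchreier := p.z_artinSchreier
  y_sq := p.u_sq
  z_artinSchreier := p.x_artinSchreier
  u_sq := p.y_sq
  xy := p.zu
  zu := p.xy
  xz := p.xz.symm
  xu := p.yz.symm
  yz := p.xu.symm
  yu := p.yu.symm
  generate := by
    rw [← p.generate]
    congr 1
    ext a
    simp only [Set.mem_insert_iff, Set.mem_singleton_iff]
    tauto

/-- Two quadruples are identified when they agree up to the order of the two pairs. -/
def swapSetoid (F A : Type*) [Field F] [Ring A] [Algebra F A] : Setoid (GenQuadruple F A) where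
  r p q := q = p ∨ q = p.swap
  iseqv :=
    { refl := fun _ => Or.inl rfl
      symm := by
        rintro p q (rfl | rfl)
        · exact Or.inl rfl
        · exact Or.inr rfl
      trans := by
        rintro p q r (rfl | rfl) (rfl | rfl)
        · exact Or.inl rfl
        · exact Or.inr rfl
        · exact Or.inr rfl
        · exact Or.inl rfl }

end GenQuadruple

/-- Quadruples of standard generators, with `(x, y, z, u)` and `(z, u, x, y)` identified. -/
def Quadruple (F A : Type*) [Field F] [Ring A] [Algebra F A] : Type _ :=
  Quotient (GenQuadruple.swapSetoid F A)

namespace Quadruple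

variable {F A : Type*} [Field F] [Ring A] [Algebra F A]

/-- The class of an ordered quadruple. -/
def mk (p : GenQuadruple F A) : Quadruple F A :=
  Quotient.mk (GenQuadruple.swapSetoid F A) p

/-- A step of type `Λ₃`: at most three of the four generators are changed, that is, for suitable
orders of the pairs at least one of the four entries is kept. -/
def LambdaThree (P Q : Quadruple F A) : Prop :=
  ∃ p q : GenQuadruple F A, mk p = P ∧ mk q = Q ∧
    (p.x = q.x ∨ p.y = q.y ∨ p.z = q.z ∨ p.u = q.u)

/-- `P` and `Q` are connected by a chain of exactly `n` steps of type `Λ₃`. -/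
def ConnectedInSteps (n : ℕ) (P Q : Quadruple F A) : Prop :=
  ∃ c : Fin (n + 1) → Quadruple F A, c 0 = P ∧ c (Fin.last n) = Q ∧
    ∀ i : Fin n, LambdaThree (c i.castSucc) (c i.succ)

end Quadruple

/-!
For square-central generators `y` of the first quadruple and `y'` of the second, it is enough to find
quadruples `R₁ ∋ y` and `R₂ ∋ y'` that share a generator: then `P, R₁, R₂, Q` is the chain.

The element `s = y y' + y' y` commutes with `y` and `y'`.

* If `s` is a nonzero scalar, then `x = s⁻¹ y y'` satisfies `x y + y x = y`, `x y' + y' x = y'` and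
  `x² + x ∈ F`, so it is a common partner of `y` and `y'` (`exists_common_x`), and each of the pairs
  `(x, y)`, `(x, y')` extends to a quadruple (`exists_genQuadruple_of_pair`).
* If `s` is not a scalar, then it is quadratic over `F` (`exists_sq_eq_of_commute`), and a multiple
  `w` of it satisfies `w² + w ∈ F` or `w² ∈ F`. Each of `{y, w}`, `{y', w}` extends to a quadruple in
  which `w` belongs to the other pair (`exists_genQuadruple_y_z`, `exists_genQuadruple_y_u`).
* If `s = 0`, then `y` and `y'` commute. When they generate a field of degree four, `{y, y'}` extends
  to a quadruple in the same way; otherwise `y` lies in the quaternion algebra centralizing the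
  second pair of `Q`, and completes this pair to a quadruple.

To extend commuting `y` and `w` with `L = F[y, w]` of degree four, one finds an element `x` that
commutes with `w` and satisfies `x y + y x = y`. Since `L` is its own centralizer
(`eq_add_of_commute_commute`), `x² + x = p + q w` with `p, q ∈ F` (`exists_sq_add_self_mem`). If
`w² ∈ F`, then `x + q w` is as desired (`exists_pair_of_sq`). If `w² + w ∈ F`, there is an involution
`τ` of the algebra with `τ y = y` and `τ w = w + 1` (`exists_isLinearInvolution_map_eq`); then
`τ x = x + a + b y` with `a, b ∈ F`, whence `q = a² + a + b² y²`, and `x + a w + b w y` is as desired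
(`exists_pair_of_sq_add_self`). This is the only place where the tensor product decomposition is used
for more than the dimension `16`.

The structure theory of the algebra (centralizers, generation) is obtained by counting dimensions: a
noncommuting pair `a, b` makes `1, a, b, a b` left independent over its centralizer
(`eq_zero_of_not_commute`). That enough elements do not commute follows from the independence theorem
of Artin and Whaples (`eq_zero_of_sum_mul_mul`).
-/

open Module

/-! ### Centralizers and dimensions -/

section Dimension

variable {F A : Type*} [Field F] [DivisionRing A] [Algebra F A]

/-- If `a` and `b` do not commute, then `1, a, b, a b` are left linearly independent over the
common centralizer of `a` and `b`. -/
theorem eq_zero_of_not_commute {a b : A} (hab : ¬ Commute a b) {g₀ g₁ g₂ g₃ : A}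
    (ha₀ : Commute g₀ a) (hb₀ : Commute g₀ b) (ha₁ : Commute g₁ a) (hb₁ : Commute g₁ b)
    (ha₂ : Commute g₂ a) (hb₂ : Commute g₂ b) (ha₃ : Commute g₃ a) (hb₃ : Commute g₃ b)
    (h : g₀ + g₁ * a + g₂ * b + g₃ * (a * b) = 0) : g₀ = 0 ∧ g₁ = 0 ∧ g₂ = 0 ∧ g₃ = 0 := by
  have hne : b * a - a * b ≠ 0 := fun h0 => hab (sub_eq_zero.mp h0).symm
  have h1 : (g₂ + g₃ * a) * (b * a - a * b) = 0 := by
    have e : a * (g₀ + g₁ * a + g₂ * b + g₃ * (a * b))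
        = g₀ * a + g₁ * a * a + g₂ * a * b + g₃ * a * (a * b) := by
      simp only [mul_add, ← mul_assoc, ha₀.symm.eq, ha₁.symm.eq, ha₂.symm.eq, ha₃.symm.eq]
    have e' : (g₀ + g₁ * a + g₂ * b + g₃ * (a * b)) * a
        - a * (g₀ + g₁ * a + g₂ * b + g₃ * (a * b)) = (g₂ + g₃ * a) * (b * a - a * b) := by
      rw [e]; noncomm_ring
    rw [← e', h]; simp
  have h2 : g₂ + g₃ * a = 0 := (mul_eq_zero.mp h1).resolve_right hne
  have aux : ∀ {p q : A}, Commute p b → Commute q b → p + q * a = 0 → p = 0 ∧ q = 0 := by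
    intro p q hp hq hpq
    have e : q * (b * a - a * b) = b * (p + q * a) - (p + q * a) * b := by
      simp only [mul_add, ← mul_assoc, hp.symm.eq, hq.symm.eq]; noncomm_ring
    have hq0 : q = 0 := by
      rw [hpq, mul_zero, zero_mul, sub_zero] at e
      exact (mul_eq_zero.mp e).resolve_right hne
    exact ⟨by simpa [hq0] using hpq, hq0⟩
  obtain ⟨h20, h30⟩ := aux hb₂ hb₃ h2
  obtain ⟨h00, h10⟩ := aux hb₀ hb₁ (by simpa [h20, h30] using h)
  exact ⟨h00, h10, h20, h30⟩

/-- If the elements of `m` are left linearly independent over `V`, a subspace containing all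
products `v * m i` has dimension at least `k * dim V`. -/
theorem mul_finrank_le [FiniteDimensional F A] {k : ℕ} (V W : Submodule F A) (m : Fin k → A)
    (hW : ∀ v ∈ V, ∀ i, v * m i ∈ W)
    (hind : ∀ v : Fin k → A, (∀ i, v i ∈ V) → ∑ i, v i * m i = 0 → ∀ i, v i = 0) :
    k * finrank F V ≤ finrank F W := by
  let f : (Fin k → V) →ₗ[F] W :=
    { toFun := fun v => ⟨∑ i, (v i : A) * m i, W.sum_mem fun i _ => hW _ (v i).2 i⟩
      map_add' := fun v w => by
        ext; simp [add_mul, Finset.sum_add_distrib]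
      map_smul' := fun c v => by
        ext; simp [Finset.smul_sum] }
  have hf : Function.Injective f := by
    rw [← LinearMap.ker_eq_bot, LinearMap.ker_eq_bot']
    intro v hv
    have hv' : ∑ i, (v i : A) * m i = 0 := congrArg Subtype.val hv
    funext i
    exact Subtype.ext (hind (fun i => v i) (fun i => (v i).2) hv' i)
  simpa [Module.finrank_pi_fintype] using LinearMap.finrank_le_finrank_of_injective hf

theorem four_mul_finrank_le [FiniteDimensional F A] (V W : Submodule F A) {a b : A}
    (hab : ¬ Commute a b) (hVa : ∀ v ∈ V, Commute v a) (hVb : ∀ v ∈ V, Commute v b)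
    (h1 : V ≤ W) (ha : ∀ v ∈ V, v * a ∈ W) (hb : ∀ v ∈ V, v * b ∈ W)
    (hc : ∀ v ∈ V, v * (a * b) ∈ W) : 4 * finrank F V ≤ finrank F W := by
  refine mul_finrank_le V W ![1, a, b, a * b] ?_ ?_
  · intro v hv i
    fin_cases i
    · simpa using h1 hv
    · exact ha v hv
    · exact hb v hv
    · exact hc v hv
  · intro v hv h
    simp only [Fin.sum_univ_four, Matrix.cons_val, mul_one] at h
    obtain ⟨h0, h1, h2, h3⟩ := eq_zero_of_not_commute hab (hVa _ (hv 0)) (hVb _ (hv 0))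
      (hVa _ (hv 1)) (hVb _ (hv 1)) (hVa _ (hv 2)) (hVb _ (hv 2)) (hVa _ (hv 3)) (hVb _ (hv 3)) h
    intro i
    fin_cases i <;> assumption

variable (F) in
theorem mem_centralizer_pair {a b w : A} :
    w ∈ (Subalgebra.centralizer F {a, b}) ↔ Commute w a ∧ Commute w b := by
  simp only [Subalgebra.mem_centralizer_iff, Set.mem_insert_iff, Set.mem_singleton_iff,
    forall_eq_or_imp, forall_eq]
  exact ⟨fun h => ⟨h.1.symm, h.2.symm⟩, fun h => ⟨h.1.symm, h.2.symm⟩⟩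

/-- The centralizer of two noncommuting elements has dimension at most four. -/
theorem finrank_centralizer_pair_le (hA : finrank F A = 16) {a b : A} (hab : ¬ Commute a b) :
    finrank F (Subalgebra.toSubmodule (Subalgebra.centralizer F {a, b})) ≤ 4 := by
  have : FiniteDimensional F A := .of_finrank_pos (by omega)
  have := four_mul_finrank_le (Subalgebra.toSubmodule (Subalgebra.centralizer F {a, b})) ⊤ hab
    (fun v hv => ((mem_centralizer_pair F).mp hv).1) (fun v hv => ((mem_centralizer_pair F).mp hv).2)
    (by simp) (by simp) (by simp) (by simp)
  rw [finrank_top, hA] at this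
  omega

/-- Two commuting noncommutative pairs in a division algebra of dimension `16` have only scalars in
their common centralizer. -/
theorem exists_algebraMap_of_commute (hA : finrank F A = 16) {a b c d : A}
    (hab : ¬ Commute a b) (hcd : ¬ Commute c d) (hac : Commute a c) (had : Commute a d)
    (hbc : Commute b c) (hbd : Commute b d) {w : A} (ha : Commute w a) (hb : Commute w b)
    (hc : Commute w c) (hd : Commute w d) : ∃ r : F, w = algebraMap F A r := by
  have : FiniteDimensional F A := .of_finrank_pos (by omega)
  set V := Subalgebra.toSubmodule
    (Subalgebra.centralizer F {a, b} ⊓ Subalgebra.centralizer F {c, d}) with hV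
  have hmem : ∀ v, v ∈ V ↔ (Commute v a ∧ Commute v b) ∧ (Commute v c ∧ Commute v d) := by
    intro v
    rw [hV, Subalgebra.mem_toSubmodule, Algebra.mem_inf, mem_centralizer_pair,
      mem_centralizer_pair]
  have h4 : 4 * finrank F V ≤
      finrank F (Subalgebra.toSubmodule (Subalgebra.centralizer F {a, b})) := by
    refine four_mul_finrank_le V _ hcd (fun v hv => ((hmem v).mp hv).2.1)
      (fun v hv => ((hmem v).mp hv).2.2) ?_ ?_ ?_ ?_
    · intro v hv
      exact (mem_centralizer_pair F).mpr ((hmem v).mp hv).1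
    all_goals
      intro v hv
      have := ((hmem v).mp hv).1
      refine (mem_centralizer_pair F).mpr ⟨this.1.mul_left ?_, this.2.mul_left ?_⟩
    · exact hac.symm
    · exact hbc.symm
    · exact had.symm
    · exact hbd.symm
    · exact hac.symm.mul_left had.symm
    · exact hbc.symm.mul_left hbd.symm
  have h1 : finrank F V ≤ 1 := by
    have := finrank_centralizer_pair_le hA hab
    omega
  have hone : (1 : A) ∈ V := (hmem 1).mpr ⟨⟨.one_left _, .one_left _⟩, .one_left _, .one_left _⟩
  have hw : w ∈ V := (hmem w).mpr ⟨⟨ha, hb⟩, hc, hd⟩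
  have hle : Submodule.span F {(1 : A)} ≤ V := by
    rw [Submodule.span_le]; simpa using hone
  have heq := Submodule.eq_of_le_of_finrank_le hle
    (by rw [finrank_span_singleton one_ne_zero]; exact h1)
  rw [← heq, Submodule.mem_span_singleton] at hw
  obtain ⟨r, hr⟩ := hw
  exact ⟨r, by rw [← hr, Algebra.algebraMap_eq_smul_one]⟩

/-- Two commuting noncommutative pairs generate a division algebra of dimension `16`. -/
theorem adjoin_eq_top (hA : finrank F A = 16) {a b c d : A}
    (hab : ¬ Commute a b) (hcd : ¬ Commute c d) (hac : Commute a c) (had : Commute a d)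
    (hbc : Commute b c) (hbd : Commute b d) : Algebra.adjoin F ({a, b, c, d} : Set A) = ⊤ := by
  have : FiniteDimensional F A := .of_finrank_pos (by omega)
  set S := Algebra.adjoin F ({a, b, c, d} : Set A) with hS
  have haS : a ∈ S := Algebra.subset_adjoin (by simp)
  have hbS : b ∈ S := Algebra.subset_adjoin (by simp)
  have hcS : c ∈ S := Algebra.subset_adjoin (by simp)
  have hdS : d ∈ S := Algebra.subset_adjoin (by simp)
  set V := Subalgebra.toSubmodule (S ⊓ Subalgebra.centralizer F {a, b}) with hV
  have hmem : ∀ v, v ∈ V ↔ v ∈ S ∧ (Commute v a ∧ Commute v b) := by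
    intro v
    rw [hV, Subalgebra.mem_toSubmodule, Algebra.mem_inf, mem_centralizer_pair]
  have h1 : 4 * finrank F (Submodule.span F {(1 : A)}) ≤ finrank F V := by
    have hscal : ∀ v ∈ Submodule.span F {(1 : A)}, ∃ r : F, v = algebraMap F A r := by
      intro v hv
      obtain ⟨r, hr⟩ := Submodule.mem_span_singleton.mp hv
      exact ⟨r, by rw [← hr, Algebra.algebraMap_eq_smul_one]⟩
    refine four_mul_finrank_le _ V hcd ?_ ?_ ?_ ?_ ?_ ?_ <;> intro v hv <;>
      obtain ⟨r, rfl⟩ := hscal v hv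
    · exact Algebra.commutes _ _
    · exact Algebra.commutes _ _
    · exact (hmem _).mpr ⟨S.algebraMap_mem r, Algebra.commutes _ _, Algebra.commutes _ _⟩
    · exact (hmem _).mpr ⟨S.mul_mem (S.algebraMap_mem r) hcS,
        Commute.mul_left (Algebra.commutes _ _) hac.symm,
        Commute.mul_left (Algebra.commutes _ _) hbc.symm⟩
    · exact (hmem _).mpr ⟨S.mul_mem (S.algebraMap_mem r) hdS,
        Commute.mul_left (Algebra.commutes _ _) had.symm,
        Commute.mul_left (Algebra.commutes _ _) hbd.symm⟩
    · exact (hmem _).mpr ⟨S.mul_mem (S.algebraMap_mem r) (S.mul_mem hcS hdS),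
        Commute.mul_left (Algebra.commutes _ _) (hac.symm.mul_left had.symm),
        Commute.mul_left (Algebra.commutes _ _) (hbc.symm.mul_left hbd.symm)⟩
  have h2 : 4 * finrank F V ≤ finrank F (Subalgebra.toSubmodule S) := by
    refine four_mul_finrank_le V _ hab (fun v hv => ((hmem v).mp hv).2.1)
      (fun v hv => ((hmem v).mp hv).2.2) ?_ ?_ ?_ ?_ <;> intro v hv <;>
      have hvS := ((hmem v).mp hv).1
    · exact hvS
    · exact S.mul_mem hvS haS
    · exact S.mul_mem hvS hbS
    · exact S.mul_mem hvS (S.mul_mem haS hbS)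
  rw [finrank_span_singleton one_ne_zero] at h1
  rw [← Algebra.toSubmodule_eq_top]
  apply Submodule.eq_top_of_finrank_eq
  have := Submodule.finrank_le (Subalgebra.toSubmodule S)
  omega

/-- In a division algebra of dimension `16`, a nonscalar element whose centralizer is not
commutative is quadratic: otherwise `1, w, w²` are independent, the centralizer of `w` has dimension
at least `12`, and it cannot be a proper division subalgebra. -/
theorem exists_sq_eq_of_commute (hA : finrank F A = 16) {a b w t : A}
    (hab : ¬ Commute a b) (ha : Commute w a) (hb : Commute w b) (ht : ¬ Commute w t) :
    ∃ p q : F, w ^ 2 = algebraMap F A p * w + algebraMap F A q := by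
  have : FiniteDimensional F A := .of_finrank_pos (by omega)
  by_contra hcon
  push Not at hcon
  have hnw : ∀ r : F, w ≠ algebraMap F A r := by
    rintro r rfl
    exact ht (Algebra.commutes _ _)
  have hli : LinearIndependent F ![1, w, w ^ 2] := by
    rw [Fintype.linearIndependent_iff]
    intro g hg
    simp only [Fin.sum_univ_three, Matrix.cons_val, Algebra.smul_def, mul_one] at hg
    have h2 : g 2 = 0 := by
      by_contra h2
      apply hcon (-(g 2)⁻¹ * g 1) (-(g 2)⁻¹ * g 0)
      have h2' : algebraMap F A (g 2) ≠ 0 := by simpa using h2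
      apply mul_left_cancel₀ h2'
      rw [mul_add, ← mul_assoc, ← map_mul, ← map_mul, neg_mul, neg_mul, mul_neg, mul_neg,
        ← mul_assoc, ← mul_assoc, mul_inv_cancel₀ h2, one_mul, one_mul, map_neg, map_neg]
      rw [eq_comm, ← sub_eq_zero, ← neg_eq_zero, ← hg]
      noncomm_ring
    have h1 : g 1 = 0 := by
      by_contra h1
      apply hnw (-(g 1)⁻¹ * g 0)
      have h1' : algebraMap F A (g 1) ≠ 0 := by simpa using h1
      apply mul_left_cancel₀ h1'
      rw [← map_mul, neg_mul, mul_neg, ← mul_assoc, mul_inv_cancel₀ h1, one_mul, map_neg]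
      rw [← sub_eq_zero, ← hg, h2]
      simp [add_comm]
    have h0 : g 0 = 0 := by simpa [h1, h2] using hg
    intro i
    fin_cases i <;> assumption
  have hV : finrank F (Submodule.span F (Set.range ![1, w, w ^ 2])) = 3 := by
    rw [finrank_span_eq_card hli]; rfl
  have hmemC : ∀ v, v ∈ Subalgebra.toSubmodule (Subalgebra.centralizer F {w}) ↔ Commute v w := by
    intro v
    simp [Subalgebra.mem_centralizer_iff, commute_iff_eq, eq_comm]
  have hVw : ∀ c, Commute w c → ∀ v ∈ Submodule.span F (Set.range ![1, w, w ^ 2]),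
      Commute v c := by
    intro c hc v hv
    induction hv using Submodule.span_induction with
    | mem x hx =>
      obtain ⟨i, rfl⟩ := hx
      fin_cases i
      · exact .one_left _
      · exact hc
      · exact hc.pow_left 2
    | zero => exact .zero_left _
    | add x y _ _ hx hy => exact hx.add_left hy
    | smul r x _ hx => exact hx.smul_left r
  have h1 : 4 * finrank F (Submodule.span F (Set.range ![1, w, w ^ 2])) ≤
      finrank F (Subalgebra.toSubmodule (Subalgebra.centralizer F {w})) := by
    refine four_mul_finrank_le _ _ hab (hVw a ha) (hVw b hb) ?_ ?_ ?_ ?_ <;> intro v hv <;>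
      rw [hmemC] <;> have := hVw w rfl v hv
    · exact this
    · exact this.mul_left ha.symm
    · exact this.mul_left hb.symm
    · exact this.mul_left (ha.symm.mul_left hb.symm)
  have h2 : 2 * finrank F (Subalgebra.toSubmodule (Subalgebra.centralizer F {w})) ≤
      finrank F (⊤ : Submodule F A) := by
    refine mul_finrank_le _ _ ![1, t] (by simp) ?_
    intro v hv h
    simp only [Fin.sum_univ_two, Matrix.cons_val, mul_one] at h
    have e0 := (hmemC _).mp (hv 0)
    have e1 := (hmemC _).mp (hv 1)
    have e : v 1 * (w * t - t * w) = 0 := by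
      have e : w * (v 0 + v 1 * t) - (v 0 + v 1 * t) * w = v 1 * (w * t - t * w) := by
        simp only [mul_add, ← mul_assoc, e0.symm.eq, e1.symm.eq]; noncomm_ring
      rw [← e, h]; simp
    have e1 : v 1 = 0 := (mul_eq_zero.mp e).resolve_right fun h0 => ht (sub_eq_zero.mp h0)
    have e0 : v 0 = 0 := by simpa [e1] using h
    intro i
    fin_cases i <;> assumption
  rw [finrank_top] at h2
  omega

/-- The Artin–Whaples independence theorem for division algebras: if `a i` are linearly independent
over the center and `∑ a i * t * b i` vanishes for all `t`, then all `b i` vanish. -/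
theorem eq_zero_of_sum_mul_mul (hZ : ∀ w : A, (∀ t, Commute w t) → ∃ r : F, w = algebraMap F A r) :
    ∀ {n : ℕ} (a b : Fin n → A), LinearIndependent F a →
      (∀ t, ∑ i, a i * t * b i = 0) → ∀ i, b i = 0 := by
  intro n
  induction n with
  | zero => intro a b _ _ i; exact i.elim0
  | succ n ih =>
    intro a b ha h
    have ha' : LinearIndependent F (fun i : Fin n => a i.succ) :=
      ha.comp _ (Fin.succ_injective n)
    by_cases hb0 : b 0 = 0
    · have hs := ih (fun i => a i.succ) (fun i => b i.succ) ha' (fun t => by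
        have := h t
        rwa [Fin.sum_univ_succ, hb0, mul_zero, zero_add] at this)
      intro i
      exact Fin.cases hb0 hs i
    · exfalso
      -- after scaling `b 0` to `1`, commutators shorten the relation, so all `b i` are central
      set c : Fin (n + 1) → A := fun i => b i * (b 0)⁻¹ with hc
      have hc0 : c 0 = 1 := mul_inv_cancel₀ hb0
      have hcs : ∀ t, ∑ i, a i * t * c i = 0 := by
        intro t
        simp only [hc, ← mul_assoc]
        rw [← Finset.sum_mul, h t, zero_mul]
      have hcen : ∀ s, ∀ i : Fin n, s * c i.succ - c i.succ * s = 0 := by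
        intro s
        apply ih (fun i => a i.succ) (fun i => s * c i.succ - c i.succ * s) ha'
        intro t
        have e : ∑ i, a i * (t * s) * c i - (∑ i, a i * t * c i) * s = 0 := by
          rw [hcs, hcs, zero_mul, sub_zero]
        rw [Finset.sum_mul, ← Finset.sum_sub_distrib, Fin.sum_univ_succ, hc0] at e
        rw [← e]
        simp only [mul_sub, mul_one, mul_assoc, sub_self, zero_add]
      have hcF : ∀ i, ∃ r : F, c i = algebraMap F A r := by
        intro i
        apply hZ
        intro s
        refine Fin.cases ?_ (fun j => ?_) i
        · rw [hc0]; exact .one_left s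
        · exact (sub_eq_zero.mp (hcen s j)).symm
      choose r hr using hcF
      have h1 := hcs 1
      have h2 : ∑ i, r i • a i = 0 := by
        rw [← h1]
        refine Finset.sum_congr rfl fun i _ => ?_
        rw [hr, mul_one, Algebra.smul_def, Algebra.commutes]
      have h3 := Fintype.linearIndependent_iff.mp ha r h2 0
      have h4 := hr 0
      rw [h3, hc0, map_zero] at h4
      exact one_ne_zero h4

/-- Multiplication in the quadratic algebra `F + F z`. -/
theorem add_mul_mul_add_mul {z : A} {e f : F}
    (hz : z ^ 2 = algebraMap F A e * z + algebraMap F A f) (p q r s : F) :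
    (algebraMap F A p + algebraMap F A q * z) * (algebraMap F A r + algebraMap F A s * z) =
      algebraMap F A (p * r + q * s * f) + algebraMap F A (p * s + q * r + q * s * e) * z := by
  have h : (Polynomial.C p + Polynomial.C q * Polynomial.X) *
      (Polynomial.C r + Polynomial.C s * Polynomial.X) = Polynomial.C (p * r) +
      Polynomial.C (p * s + q * r) * Polynomial.X + Polynomial.C (q * s) * Polynomial.X ^ 2 := by
    simp only [Polynomial.C_add, Polynomial.C_mul]
    ring
  have h' := congrArg (Polynomial.aeval z) h
  simp only [map_mul (Polynomial.aeval z), map_add (Polynomial.aeval z),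
    map_pow (Polynomial.aeval z), Polynomial.aeval_C, Polynomial.aeval_X, hz] at h'
  rw [h']
  simp only [map_add, map_mul, mul_add, add_mul, mul_assoc]
  abel

/-- If `F + F z` is a quadratic field not containing `y`, then `1, y, z, y z` are independent. -/
theorem linearIndependent_of_quadratic {y z : A} {e f : F}
    (hz : z ^ 2 = algebraMap F A e * z + algebraMap F A f) (hyz : Commute y z)
    (hzF : ∀ r : F, z ≠ algebraMap F A r)
    (hyF : ∀ p q : F, y ≠ algebraMap F A p + algebraMap F A q * z) :
    LinearIndependent F ![1, y, z, y * z] := by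
  have hFz : ∀ p q : F, algebraMap F A p + algebraMap F A q * z = 0 → p = 0 ∧ q = 0 := by
    intro p q h
    have hq : q = 0 := by
      by_contra hq
      apply hzF (-(q⁻¹ * p))
      have : algebraMap F A q * z = -algebraMap F A p := by
        rw [eq_neg_iff_add_eq_zero, add_comm, h]
      rw [map_neg, map_mul, ← mul_neg, ← this, ← mul_assoc, ← map_mul, inv_mul_cancel₀ hq,
        map_one, one_mul]
    subst hq
    simpa using h
  rw [Fintype.linearIndependent_iff]
  intro g hg
  simp only [Fin.sum_univ_four, Matrix.cons_val, Algebra.smul_def, mul_one] at hg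
  have hg' : (algebraMap F A (g 0) + algebraMap F A (g 2) * z)
      + (algebraMap F A (g 1) + algebraMap F A (g 3) * z) * y = 0 := by
    rw [← hg, hyz.eq]; noncomm_ring
  -- otherwise `y` is a quotient of elements of `F + F z`, which is closed under inversion
  have h13 : g 1 = 0 ∧ g 3 = 0 := by
    by_contra hne
    have hprod := add_mul_mul_add_mul hz (g 1 + g 3 * e) (-g 3) (g 1) (g 3)
    rw [show (g 1 + g 3 * e) * g 3 + -g 3 * g 1 + -g 3 * g 3 * e = 0 by ring, map_zero, zero_mul,
      add_zero] at hprod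
    set n : F := (g 1 + g 3 * e) * g 1 + -g 3 * g 3 * f with hn
    have hn0 : n ≠ 0 := by
      intro h0
      rw [h0, map_zero] at hprod
      rcases mul_eq_zero.mp hprod with h | h
      · obtain ⟨h3, h4⟩ := hFz _ _ h
        rw [neg_eq_zero] at h4
        rw [h4, zero_mul, add_zero] at h3
        exact hne ⟨h3, h4⟩
      · exact hne (hFz _ _ h)
    have h := congrArg
      ((algebraMap F A (g 1 + g 3 * e) + algebraMap F A (-g 3) * z) * ·) hg'
    rw [mul_add, ← mul_assoc, hprod, add_mul_mul_add_mul hz, mul_zero, add_comm,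
      add_eq_zero_iff_eq_neg] at h
    obtain ⟨r, s, hrs⟩ : ∃ r s : F, algebraMap F A n * y = -(algebraMap F A r + algebraMap F A s * z) :=
      ⟨_, _, h⟩
    apply hyF (-(n⁻¹ * r)) (-(n⁻¹ * s))
    rw [← inv_mul_cancel_left₀ (by simpa using hn0 : algebraMap F A n ≠ 0) y, hrs, ← map_inv₀,
      map_neg, map_neg, map_mul, map_mul]
    noncomm_ring
  rw [h13.1, h13.2] at hg'
  have h02 := hFz (g 0) (g 2) (by simpa using hg')
  intro i
  fin_cases i
  exacts [h02.1, h13.1, h02.2, h13.2]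

/-- A commutative subfield of degree four in a division algebra of dimension `16` is its own
centralizer. -/
theorem eq_add_of_commute_commute (hA : finrank F A = 16) {y z x v w : A}
    (hyz : Commute y z) (hli : LinearIndependent F ![1, y, z, y * z])
    (hxy : ¬ Commute x y) (hvy : Commute v y) (hvz : ¬ Commute v z)
    (hwy : Commute w y) (hwz : Commute w z) :
    ∃ a b c d : F, w = (algebraMap F A a + algebraMap F A c * z)
      + (algebraMap F A b + algebraMap F A d * z) * y := by
  have : FiniteDimensional F A := .of_finrank_pos (by omega)
  have aux : ∀ {a b g₀ g₁ : A}, Commute g₀ a → Commute g₁ a → ¬ Commute b a →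
      g₀ + g₁ * b = 0 → g₀ = 0 ∧ g₁ = 0 := by
    intro a b g₀ g₁ h₀ h₁ hba h
    have e : g₁ * (b * a - a * b) = (g₀ + g₁ * b) * a - a * (g₀ + g₁ * b) := by
      simp only [mul_add, ← mul_assoc, h₀.symm.eq, h₁.symm.eq]; noncomm_ring
    rw [h, zero_mul, mul_zero, sub_zero] at e
    have h1 : g₁ = 0 := (mul_eq_zero.mp e).resolve_right fun h0 => hba (sub_eq_zero.mp h0)
    exact ⟨by simpa [h1] using h, h1⟩
  have h4 : 4 * finrank F (Subalgebra.toSubmodule (Subalgebra.centralizer F {y, z})) ≤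
      finrank F (⊤ : Submodule F A) := by
    refine mul_finrank_le _ _ ![1, v, x, v * x] (by simp) ?_
    intro g hg h
    simp only [Fin.sum_univ_four, Matrix.cons_val, mul_one] at h
    have hg' : ∀ i, Commute (g i) y ∧ Commute (g i) z :=
      fun i => (mem_centralizer_pair F).mp (hg i)
    have h' : (g 0 + g 1 * v) + (g 2 + g 3 * v) * x = 0 := by
      rw [← h]; noncomm_ring
    obtain ⟨h01, h23⟩ := aux ((hg' 0).1.add_left ((hg' 1).1.mul_left hvy))
      ((hg' 2).1.add_left ((hg' 3).1.mul_left hvy)) hxy h'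
    obtain ⟨h0, h1⟩ := aux (hg' 0).2 (hg' 1).2 hvz h01
    obtain ⟨h2, h3⟩ := aux (hg' 2).2 (hg' 3).2 hvz h23
    intro i
    fin_cases i <;> assumption
  rw [finrank_top, hA] at h4
  have hle : Submodule.span F (Set.range ![1, y, z, y * z]) ≤
      Subalgebra.toSubmodule (Subalgebra.centralizer F {y, z}) := by
    rw [Submodule.span_le]
    rintro _ ⟨i, rfl⟩
    refine (mem_centralizer_pair F).mpr ?_
    fin_cases i
    · exact ⟨.one_left _, .one_left _⟩
    · exact ⟨rfl, hyz⟩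
    · exact ⟨hyz.symm, rfl⟩
    · exact ⟨Commute.mul_left rfl hyz.symm, hyz.mul_left rfl⟩
  have heq := Submodule.eq_of_le_of_finrank_le hle (by
    rw [finrank_span_eq_card hli, Fintype.card_fin]; omega)
  have hw : w ∈ Subalgebra.toSubmodule (Subalgebra.centralizer F {y, z}) :=
    (mem_centralizer_pair F).mpr ⟨hwy, hwz⟩
  rw [← heq, Submodule.mem_span_range_iff_exists_fun] at hw
  obtain ⟨c, hc⟩ := hw
  simp only [Fin.sum_univ_four, Matrix.cons_val, Algebra.smul_def, mul_one] at hc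
  refine ⟨c 0, c 1, c 2, c 3, ?_⟩
  rw [← hc, hyz.eq]
  noncomm_ring

end Dimension

/-! ### Commutators in characteristic two -/

section CharTwo

set_option linter.unusedSimpArgs false

variable {F A : Type*} [Field F] [DivisionRing A] [Algebra F A] [CharP A 2]

theorem commute_iff_add_eq_zero {a b : A} : Commute a b ↔ a * b + b * a = 0 :=
  CharTwo.add_eq_zero.symm

/-- A quotient of two eigenvectors of `x` (acting by commutation) for the eigenvalue `1` commutes
with `x`. -/
theorem commute_mul_inv {x y q : A} (hy : y ≠ 0) (hxy : x * y + y * x = y)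
    (hq : x * q + q * x = q) : Commute (q * y⁻¹) x := by
  obtain ⟨d, rfl⟩ : ∃ d, q = d * y := ⟨q * y⁻¹, by simp [hy]⟩
  rw [mul_inv_cancel_right₀ hy, commute_iff_add_eq_zero]
  have h1 : y * x = x * y + y := by
    rw [← CharTwo.add_eq_zero]; nth_rw 3 [← hxy]
    simp only [add_assoc, add_comm, add_left_comm, CharTwo.add_cancel_left,
      CharTwo.add_self_eq_zero]
  have h2 : (d * x + x * d) * y = 0 := by
    rw [mul_assoc, h1, ← CharTwo.add_eq_zero] at hq
    rw [← hq]
    simp only [mul_add, add_mul, mul_assoc, add_assoc, add_comm, add_left_comm,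
      CharTwo.add_cancel_left, CharTwo.add_self_eq_zero, add_zero]
  exact (mul_eq_zero.mp h2).resolve_right hy

/-- Commutation with `x` is an idempotent operator if `x² + x` is central. -/
theorem commutator_idem {x : A} {α : F} (hx : x ^ 2 + x = algebraMap F A α) (a : A) :
    x * (x * a + a * x) + (x * a + a * x) * x = x * a + a * x := by
  have hx2 : x * x = x + algebraMap F A α := by
    rw [← hx, pow_two, add_comm (x * x), CharTwo.add_cancel_left]
  have e : x * (x * a + a * x) + (x * a + a * x) * x = x * x * a + a * (x * x) := by
    simp only [mul_add, add_mul, mul_assoc, add_assoc, add_comm, add_left_comm,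
      CharTwo.add_cancel_left, CharTwo.add_self_eq_zero, add_zero]
  rw [e, hx2, mul_add, add_mul, ← Algebra.commutes α a]
  simp only [add_assoc, add_comm, add_left_comm,
      CharTwo.add_cancel_left, CharTwo.add_self_eq_zero, add_zero]

/-- `x, y` generate a quaternion algebra, and the algebra is generated by it and its centralizer: an
element commuting with both is central. -/
theorem commute_of_commute_centralizer {x y w : A} {α β : F}
    (hx : x ^ 2 + x = algebraMap F A α) (hy0 : y ≠ 0) (hy : y ^ 2 = algebraMap F A β)
    (hxy : x * y + y * x = y) (hwx : Commute w x) (hwy : Commute w y)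
    (hw : ∀ c, Commute c x → Commute c y → Commute w c) (a : A) : Commute w a := by
  have key : ∀ r, Commute r x → Commute w r := by
    intro r hr
    set d := (y * r + r * y) * y⁻¹ with hd
    have hdy' : d * y = y * r + r * y := by rw [hd, inv_mul_cancel_right₀ hy0]
    have hdx : Commute d x := by
      apply commute_mul_inv hy0 hxy
      have e : x * (y * r + r * y) + (y * r + r * y) * x
          = (x * y + y * x) * r + r * (x * y + y * x) := by
        simp only [mul_add, add_mul, mul_assoc, hr.eq]
        simp only [← mul_assoc, hr.eq]
        simp only [mul_assoc, add_assoc, add_comm, add_left_comm]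
      rw [e, hxy]
    have hdy : Commute d y := by
      have : Commute (y * r + r * y) y := by
        have hyy : ∀ s : A, y * (y * s) = s * (y * y) := by
          intro s
          rw [← mul_assoc, ← pow_two, hy, Algebra.commutes]
        rw [commute_iff_eq]
        simp only [mul_add, add_mul, mul_assoc, hyy, add_comm]
      exact this.mul_left (Commute.refl y).inv_left₀
    have h1 : Commute (r + d * x) y := by
      rw [commute_iff_add_eq_zero]
      have e : (r + d * x) * y + y * (r + d * x)
          = (y * r + r * y) + d * (x * y + y * x) := by
        simp only [mul_add, add_mul, mul_assoc]
        simp only [← mul_assoc, hdy.symm.eq]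
        simp only [mul_assoc, add_assoc, add_comm, add_left_comm]
      rw [e, hxy, hdy', CharTwo.add_self_eq_zero]
    have h2 : Commute (r + d * x) x := hr.add_left (hdx.mul_left rfl)
    have e : r = (r + d * x) + d * x := by
      rw [add_assoc, CharTwo.add_self_eq_zero, add_zero]
    rw [e]
    exact (hw _ h2 h1).add_right ((hw d hdx hdy).mul_right hwx)
  have hp := commutator_idem hx a
  set p := x * a + a * x with hpdef
  have hc : Commute (p * y⁻¹) x := commute_mul_inv hy0 hxy hp
  have h1 : Commute (a + p) x := by
    rw [commute_iff_add_eq_zero]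
    have e : (a + p) * x + x * (a + p) = (x * a + a * x) + (x * p + p * x) := by
      simp only [mul_add, add_mul, add_assoc, add_comm, add_left_comm]
    rw [e, hp, ← hpdef, CharTwo.add_self_eq_zero]
  have e : a = (a + p) + p * y⁻¹ * y := by
    rw [inv_mul_cancel_right₀ hy0, add_assoc, CharTwo.add_self_eq_zero, add_zero]
  rw [e]
  exact (key _ h1).add_right ((key _ hc).mul_right hwy)

/-- If `y, z` generate a field of degree four, some element commutes with `z` but not with `y`. -/
theorem exists_commute_not_commute
    (hZ : ∀ w : A, (∀ t, Commute w t) → ∃ r : F, w = algebraMap F A r) {y z : A} {e f : F}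
    (hz : z ^ 2 = algebraMap F A e * z + algebraMap F A f)
    (hli : LinearIndependent F ![1, y, z, y * z]) : ∃ t, Commute t z ∧ ¬ Commute t y := by
  by_contra! hcon
  have hzz : z * z = algebraMap F A e * z + algebraMap F A f := by rw [← pow_two, hz]
  have h := eq_zero_of_sum_mul_mul hZ ![1, y, z, y * z]
    ![z * y + algebraMap F A e * y, z + algebraMap F A e, y, 1] hli (fun r => by
      have hr := hcon (z * r + r * z + algebraMap F A e * r) (by
        rw [commute_iff_add_eq_zero]
        have hef : ∀ s : A, z * (z * s) = algebraMap F A e * (z * s) + algebraMap F A f * s := by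
          intro s
          rw [← mul_assoc, hzz, add_mul, mul_assoc]
        have he' : ∀ s t : A, s * (algebraMap F A e * t) = algebraMap F A e * (s * t) :=
          fun s t => Algebra.left_comm _ _ _
        have hf : ∀ s : A, s * algebraMap F A f = algebraMap F A f * s :=
          fun s => (Algebra.commutes _ _).symm
        simp only [mul_add, add_mul, mul_assoc, hzz, hef, he', hf]
        simp only [add_assoc, add_comm, add_left_comm, CharTwo.add_cancel_left,
          CharTwo.add_self_eq_zero, add_zero])
      rw [commute_iff_add_eq_zero] at hr
      have he' : ∀ s t : A, s * (algebraMap F A e * t) = algebraMap F A e * (s * t) :=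
        fun s t => Algebra.left_comm _ _ _
      have he : ∀ s : A, s * algebraMap F A e = algebraMap F A e * s :=
          fun s => (Algebra.commutes _ _).symm
      simp only [Fin.sum_univ_four, Matrix.cons_val]
      rw [← hr]
      simp only [mul_add, add_mul, mul_assoc, he', he, one_mul, mul_one]
      simp only [add_assoc, add_comm, add_left_comm])
  simpa using h 3

/-- An element `t` that does not commute with `y` yields an eigenvector: `x = t (t y + y t)⁻¹ y`
satisfies `x y + y x = y`. -/
theorem mul_inv_mul_commutator {y t : A} {β : F} (hy : y ^ 2 = algebraMap F A β)
    (hty : ¬ Commute t y) : t * (t * y + y * t)⁻¹ * y * y + y * (t * (t * y + y * t)⁻¹ * y) = y := by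
  set s := t * y + y * t with hs
  have hs0 : s ≠ 0 := fun h => hty (commute_iff_add_eq_zero.mpr h)
  have hyy : ∀ r : A, y * (y * r) = r * (y * y) := by
    intro r
    rw [← mul_assoc, ← pow_two, hy, Algebra.commutes]
  have hsy : Commute s y := by
    rw [commute_iff_eq, hs]
    simp only [mul_add, add_mul, mul_assoc, hyy, add_comm]
  have h := hsy.inv_left₀.eq
  have e : t * s⁻¹ * y * y + y * (t * s⁻¹ * y) = (t * y + y * t) * s⁻¹ * y := by
    have h' : ∀ r : A, s⁻¹ * (y * r) = y * (s⁻¹ * r) := fun r => by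
      rw [← mul_assoc, h, mul_assoc]
    simp only [add_mul, mul_assoc, h, h']
  rw [e, ← hs, mul_inv_cancel₀ hs0, one_mul]

end CharTwo

/-! ### Completing a pair to a quadruple -/

section Completion

set_option linter.unusedSimpArgs false

variable {F A : Type*} [Field F] [DivisionRing A] [Algebra F A] [CharP A 2]

theorem commute_sq_add_self {x y : A} (hxy : x * y + y * x = y) : Commute (x ^ 2 + x) y := by
  have h : x * y = y * x + y := (CharTwo.add_eq_iff_eq_add.mp hxy).trans (add_comm _ _)
  have h' : ∀ r, x * (y * r) = y * (x * r) + y * r := fun r => by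
    rw [← mul_assoc, h, add_mul, mul_assoc]
  rw [commute_iff_eq]
  simp only [pow_two, mul_add, add_mul, mul_assoc, h, h']
  simp only [add_assoc, add_comm, add_left_comm, CharTwo.add_cancel_left,
    CharTwo.add_self_eq_zero, add_zero]

theorem commute_sq_of_commutator {x y : A} (hxy : x * y + y * x = y) : Commute (y ^ 2) x := by
  have h : x * y = y * x + y :=
    (CharTwo.add_eq_iff_eq_add.mp hxy).trans (add_comm _ _)
  have h' : ∀ r, x * (y * r) = y * (x * r) + y * r := fun r => by
    rw [← mul_assoc, h, add_mul, mul_assoc]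
  rw [commute_iff_eq]
  simp only [pow_two, mul_add, add_mul, mul_assoc, h, h']
  simp only [add_assoc, add_comm, add_left_comm, CharTwo.add_cancel_left,
    CharTwo.add_self_eq_zero, add_zero]

theorem not_commute_of_commutator {x y : A} (hy : y ≠ 0) (hxy : x * y + y * x = y) :
    ¬ Commute x y :=
  fun h => hy (hxy ▸ commute_iff_add_eq_zero.mp h)

/-- In dimension `16` the relations of a quadruple imply that it generates the algebra. -/
theorem exists_genQuadruple (hA : finrank F A = 16) {x y z u : A}
    (hx : ∃ α : F, x ^ 2 + x = algebraMap F A α) (hy0 : y ≠ 0)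
    (hy : ∃ β : F, y ^ 2 = algebraMap F A β) (hz : ∃ γ : F, z ^ 2 + z = algebraMap F A γ)
    (hu0 : u ≠ 0) (hu : ∃ δ : F, u ^ 2 = algebraMap F A δ) (hxy : x * y + y * x = y)
    (hzu : z * u + u * z = u) (hxz : Commute x z) (hxu : Commute x u) (hyz : Commute y z)
    (hyu : Commute y u) :
    ∃ R : GenQuadruple F A, R.x = x ∧ R.y = y ∧ R.z = z ∧ R.u = u := by
  obtain ⟨β, hβ⟩ := hy
  obtain ⟨δ, hδ⟩ := hu
  refine ⟨⟨x, y, z, u, hx, ⟨β, ?_, hβ⟩, hz, ⟨δ, ?_, hδ⟩, hxy, hzu, hxz, hxu, hyz, hyu, ?_⟩,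
    rfl, rfl, rfl, rfl⟩
  · rintro rfl
    exact hy0 (by simpa using hβ)
  · rintro rfl
    exact hu0 (by simpa using hδ)
  · exact adjoin_eq_top hA (not_commute_of_commutator hy0 hxy) (not_commute_of_commutator hu0 hzu)
      hxz hxu hyz hyu

/-- Double centralizer: a nonscalar element commuting with the pair `x, y` is not central in the
centralizer of this pair. -/
theorem exists_commute_pair_not_commute
    (hZ : ∀ w : A, (∀ t, Commute w t) → ∃ r : F, w = algebraMap F A r) {x y w : A}
    (hx : ∃ α : F, x ^ 2 + x = algebraMap F A α) (hy0 : y ≠ 0)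
    (hy : ∃ β : F, y ^ 2 = algebraMap F A β) (hxy : x * y + y * x = y) (hwx : Commute w x)
    (hwy : Commute w y) (hw : ∀ r : F, w ≠ algebraMap F A r) :
    ∃ t, Commute t x ∧ Commute t y ∧ ¬ Commute t w := by
  by_contra! hcon
  obtain ⟨α, hα⟩ := hx
  obtain ⟨β, hβ⟩ := hy
  obtain ⟨r, hr⟩ := hZ w (commute_of_commute_centralizer hα hy0 hβ hxy hwx hwy
    fun c h1 h2 => (hcon c h1 h2).symm)
  exact hw r hr

/-- A pair `x, y` and a square-central `u` in its centralizer extend to a quadruple. -/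
theorem exists_genQuadruple_of_sq (hA : finrank F A = 16)
    (hZ : ∀ w : A, (∀ t, Commute w t) → ∃ r : F, w = algebraMap F A r) {x y u : A}
    (hx : ∃ α : F, x ^ 2 + x = algebraMap F A α) (hy0 : y ≠ 0)
    (hy : ∃ β : F, y ^ 2 = algebraMap F A β) (hxy : x * y + y * x = y) (hux : Commute u x)
    (huy : Commute u y) (huF : ∀ r : F, u ≠ algebraMap F A r)
    (hu : ∃ δ : F, u ^ 2 = algebraMap F A δ) :
    ∃ R : GenQuadruple F A, R.x = x ∧ R.y = y ∧ R.u = u := by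
  obtain ⟨t, htx, hty, htu⟩ := exists_commute_pair_not_commute hZ hx hy0 hy hxy hux huy huF
  have hu0 : u ≠ 0 := fun h => huF 0 (by simpa using h)
  obtain ⟨δ, hδ⟩ := hu
  have hzu := mul_inv_mul_commutator hδ htu
  set z := t * (t * u + u * t)⁻¹ * u with hz
  have hcz : ∀ c, Commute t c → Commute u c → Commute z c := fun c h1 h2 =>
    (h1.mul_left ((h1.mul_left h2).add_left (h2.mul_left h1)).inv_left₀).mul_left h2
  have hzx := hcz x htx hux
  have hzy := hcz y hty huy
  have hzz : ∃ γ : F, z ^ 2 + z = algebraMap F A γ :=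
    exists_algebraMap_of_commute hA (not_commute_of_commutator hy0 hxy)
      (not_commute_of_commutator hu0 hzu) hzx.symm hux.symm hzy.symm huy.symm
      ((hzx.pow_left 2).add_left hzx) ((hzy.pow_left 2).add_left hzy)
      ((Commute.pow_left rfl 2).add_left rfl) (commute_sq_add_self hzu)
  obtain ⟨R, h1, h2, -, h4⟩ := exists_genQuadruple hA hx hy0 hy hzz hu0 ⟨δ, hδ⟩ hxy hzu hzx.symm
    hux.symm hzy.symm huy.symm
  exact ⟨R, h1, h2, h4⟩

/-- A pair `x, y` and an Artin–Schreier element `z` in its centralizer extend to a quadruple. -/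
theorem exists_genQuadruple_of_sq_add_self (hA : finrank F A = 16)
    (hZ : ∀ w : A, (∀ t, Commute w t) → ∃ r : F, w = algebraMap F A r) {x y z : A}
    (hx : ∃ α : F, x ^ 2 + x = algebraMap F A α) (hy0 : y ≠ 0)
    (hy : ∃ β : F, y ^ 2 = algebraMap F A β) (hxy : x * y + y * x = y) (hzx : Commute z x)
    (hzy : Commute z y) (hzF : ∀ r : F, z ≠ algebraMap F A r)
    (hz : ∃ γ : F, z ^ 2 + z = algebraMap F A γ) :
    ∃ R : GenQuadruple F A, R.x = x ∧ R.y = y ∧ R.z = z := by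
  obtain ⟨t, htx, hty, htz⟩ := exists_commute_pair_not_commute hZ hx hy0 hy hxy hzx hzy hzF
  obtain ⟨γ, hγ⟩ := hz
  have hzu := commutator_idem hγ t
  set u := z * t + t * z with hu
  have hu0 : u ≠ 0 := fun h => htz (commute_iff_add_eq_zero.mpr ((add_comm _ _).trans h))
  have hux : Commute u x := (hzx.mul_left htx).add_left (htx.mul_left hzx)
  have huy : Commute u y := (hzy.mul_left hty).add_left (hty.mul_left hzy)
  have huu : ∃ δ : F, u ^ 2 = algebraMap F A δ :=
    exists_algebraMap_of_commute hA (not_commute_of_commutator hy0 hxy)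
      (not_commute_of_commutator hu0 hzu) hzx.symm hux.symm hzy.symm huy.symm
      (hux.pow_left 2) (huy.pow_left 2) (commute_sq_of_commutator hzu) (Commute.pow_left rfl 2)
  obtain ⟨R, h1, h2, h3, -⟩ := exists_genQuadruple hA hx hy0 hy ⟨γ, hγ⟩ hu0 huu hxy hzu hzx.symm
    hux.symm hzy.symm huy.symm
  exact ⟨R, h1, h2, h3⟩

/-- A generator of a quadratic extension can be scaled to be a root of `T² + T + γ` (separable case)
or `T² + δ` (inseparable case). -/
theorem exists_smul_normalized {w : A} {p q : F}
    (hw : w ^ 2 = algebraMap F A p * w + algebraMap F A q) :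
    ∃ r : F, r ≠ 0 ∧ ((∃ γ : F, (r • w) ^ 2 + r • w = algebraMap F A γ) ∨
      ∃ δ : F, (r • w) ^ 2 = algebraMap F A δ) := by
  by_cases hp : p = 0
  · exact ⟨1, one_ne_zero, .inr ⟨q, by simpa [hp] using hw⟩⟩
  · refine ⟨p⁻¹, inv_ne_zero hp, .inl ⟨p⁻¹ ^ 2 * q, ?_⟩⟩
    rw [smul_pow, hw, ← Algebra.smul_def, smul_add, smul_smul,
      show p⁻¹ ^ 2 * p = p⁻¹ by field_simp, add_assoc, add_comm, add_assoc,
      CharTwo.add_self_eq_zero, add_zero, Algebra.smul_def, map_mul]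

/-- Every pair `x, y` extends to a quadruple. The noncommuting `c, d` in the centralizer of `y` ensure that the centralizer of `x, y`
is not just the center. -/
theorem exists_genQuadruple_of_pair (hA : finrank F A = 16)
    (hZ : ∀ w : A, (∀ t, Commute w t) → ∃ r : F, w = algebraMap F A r) {x y c d : A}
    (hx : ∃ α : F, x ^ 2 + x = algebraMap F A α) (hy0 : y ≠ 0)
    (hy : ∃ β : F, y ^ 2 = algebraMap F A β) (hxy : x * y + y * x = y) (hc : Commute c y)
    (hd : Commute d y) (hcd : ¬ Commute c d) :
    ∃ R : GenQuadruple F A, R.x = x ∧ R.y = y := by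
  have hxny := not_commute_of_commutator hy0 hxy
  obtain ⟨w, hwx, hwy, hwF⟩ : ∃ w, Commute w x ∧ Commute w y ∧ ∀ r : F, w ≠ algebraMap F A r := by
    by_contra! hcon
    obtain ⟨α, hα⟩ := hx
    have key : ∀ r, Commute r y → ∃ p q : F, r = algebraMap F A p + algebraMap F A q * y := by
      intro r hr
      have hp := commutator_idem hα r
      have hpy : Commute (x * r + r * x) y := by
        rw [commute_iff_add_eq_zero]
        have e : (x * r + r * x) * y + y * (x * r + r * x) =
            (x * y + y * x) * r + r * (x * y + y * x) := by
          have h' : ∀ s, y * (r * s) = r * (y * s) := fun s => by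
            rw [← mul_assoc, ← hr.eq, mul_assoc]
          simp only [mul_add, add_mul, mul_assoc, hr.eq, h']
          simp only [add_assoc, add_comm, add_left_comm]
        rw [e, hxy, hr.eq, CharTwo.add_self_eq_zero]
      obtain ⟨q, hq⟩ := hcon _ (commute_mul_inv hy0 hxy hp)
        (hpy.mul_left (Commute.refl y).inv_left₀)
      obtain ⟨p, hp'⟩ := hcon (r + (x * r + r * x)) (by
        rw [commute_iff_add_eq_zero]
        have e : (r + (x * r + r * x)) * x + x * (r + (x * r + r * x)) = (x * r + r * x) +
            (x * (x * r + r * x) + (x * r + r * x) * x) := by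
          simp only [mul_add, add_mul, add_assoc, add_comm, add_left_comm]
        rw [e, hp, CharTwo.add_self_eq_zero]) (hr.add_left hpy)
      refine ⟨p, q, ?_⟩
      rw [← hq, ← hp', inv_mul_cancel_right₀ hy0, add_assoc, CharTwo.add_self_eq_zero, add_zero]
    obtain ⟨p, q, rfl⟩ := key c hc
    exact hcd (Commute.add_left (Algebra.commutes _ _) (Commute.mul_left (Algebra.commutes _ _) hd.symm))
  obtain ⟨t, ht⟩ : ∃ t, ¬ Commute w t := by
    by_contra! h
    obtain ⟨r, hr⟩ := hZ w h
    exact hwF r hr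
  obtain ⟨p, q, hpq⟩ := exists_sq_eq_of_commute hA hxny hwx hwy ht
  obtain ⟨r, hr, h⟩ := exists_smul_normalized hpq
  have hrwF : ∀ s : F, r • w ≠ algebraMap F A s := by
    intro s hs
    apply hwF (r⁻¹ * s)
    rw [map_mul, ← hs, ← Algebra.smul_def, smul_smul, inv_mul_cancel₀ hr, one_smul]
  rcases h with h | h
  · obtain ⟨R, h1, h2, -⟩ := exists_genQuadruple_of_sq_add_self hA hZ hx hy0 hy hxy
      (hwx.smul_left r) (hwy.smul_left r) hrwF h
    exact ⟨R, h1, h2⟩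
  · obtain ⟨R, h1, h2, -⟩ := exists_genQuadruple_of_sq hA hZ hx hy0 hy hxy
      (hwx.smul_left r) (hwy.smul_left r) hrwF h
    exact ⟨R, h1, h2⟩

end Completion

/-! ### Involutions -/

section Involution

variable {F A : Type*} [Field F] [DivisionRing A] [Algebra F A]

/-- An `F`-linear involution: an anti-automorphism of order at most two that fixes the scalars. -/
def IsLinearInvolution (σ : A →ₗ[F] A) : Prop :=
  (∀ a b, σ (a * b) = σ b * σ a) ∧ ∀ a, σ (σ a) = a

theorem IsLinearInvolution.map_one {σ : A →ₗ[F] A} (hσ : IsLinearInvolution σ) : σ 1 = 1 := by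
  have h := hσ.1 (σ 1) 1
  rw [mul_one, hσ.2, mul_one] at h
  exact h.symm

theorem IsLinearInvolution.map_algebraMap {σ : A →ₗ[F] A} (hσ : IsLinearInvolution σ) (r : F) :
    σ (algebraMap F A r) = algebraMap F A r := by
  rw [Algebra.algebraMap_eq_smul_one, map_smul, hσ.map_one]

theorem IsBiquaternionAlgebra.finrank_eq (hA : IsBiquaternionAlgebra F A) : finrank F A = 16 := by
  obtain ⟨α, β, γ, δ, -, -, ⟨e⟩⟩ := hA
  rw [e.toLinearEquiv.finrank_eq, finrank_tensorProduct, QuaternionAlgebra.finrank_eq_four,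
    QuaternionAlgebra.finrank_eq_four]

/-- The tensor product of the two quaternion conjugations. -/
theorem IsBiquaternionAlgebra.exists_isLinearInvolution (hA : IsBiquaternionAlgebra F A) :
    ∃ σ : A →ₗ[F] A, IsLinearInvolution σ := by
  obtain ⟨α, β, γ, δ, -, -, ⟨e⟩⟩ := hA
  let θ := (Algebra.TensorProduct.congr (QuaternionAlgebra.starAe (R := F) (c₁ := α) (c₂ := 1)
    (c₃ := β)) (QuaternionAlgebra.starAe (R := F) (c₁ := γ) (c₂ := 1) (c₃ := δ))).trans
      (Algebra.TensorProduct.opAlgEquiv F F _ _)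
  let ψ : (SymbolAlgebra F α β ⊗[F] SymbolAlgebra F γ δ) →ₗ[F]
      (SymbolAlgebra F α β ⊗[F] SymbolAlgebra F γ δ) :=
    (MulOpposite.opLinearEquiv F).symm.toLinearMap ∘ₗ θ.toLinearMap
  have hψ : ∀ a b, ψ (a ⊗ₜ b) = star a ⊗ₜ star b := fun a b => rfl
  have hψψ : ψ ∘ₗ ψ = LinearMap.id := by
    apply TensorProduct.ext'
    intro a b
    rw [LinearMap.comp_apply, hψ, hψ, star_star, star_star, LinearMap.id_apply]
  have hψm : ∀ a b, ψ (a * b) = ψ b * ψ a := by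
    intro a b
    change MulOpposite.unop (θ (a * b)) = MulOpposite.unop (θ b) * MulOpposite.unop (θ a)
    rw [map_mul, MulOpposite.unop_mul]
  refine ⟨e.symm.toLinearMap ∘ₗ ψ ∘ₗ e.toLinearMap, fun a b => ?_, fun a => ?_⟩
  · simp [hψm]
  · have := LinearMap.congr_fun hψψ (e a)
    simp only [LinearMap.comp_apply, LinearMap.id_apply] at this
    simp [this]

end Involution

/-! ### Correcting the Artin–Schreier generator -/

section Extension

set_option linter.unusedSimpArgs false

variable {F A : Type*} [Field F] [DivisionRing A] [Algebra F A] [CharP A 2]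

/-- A symmetric `w` twists an involution `σ` into another involution, `a ↦ w σ(a) w⁻¹`. By the
Skolem–Noether argument carried out here on the biquadratic field generated by `y` and `z`, the
twisted involution can be made to fix `y` and to conjugate `z`. -/
theorem exists_isLinearInvolution_map_eq
    (hZ : ∀ w : A, (∀ t, Commute w t) → ∃ r : F, w = algebraMap F A r) {σ : A →ₗ[F] A}
    (hσ : IsLinearInvolution σ) {y z : A} {β γ : F} (hy : y ^ 2 = algebraMap F A β)
    (hz : z ^ 2 + z = algebraMap F A γ) (hyz : Commute y z)
    (hli : LinearIndependent F ![1, y, z, y * z]) :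
    ∃ τ : A →ₗ[F] A, IsLinearInvolution τ ∧ τ y = y ∧ τ z = z + 1 := by
  have hyy : y * y = algebraMap F A β := by rw [← pow_two, hy]
  have hzz : z * z = z + algebraMap F A γ := by
    rw [← hz, pow_two, add_comm (z * z), CharTwo.add_cancel_left]
  have hyy' : σ y * σ y = algebraMap F A β := by rw [← hσ.1, hyy, hσ.map_algebraMap]
  have hzz' : σ z * σ z = σ z + algebraMap F A γ := by
    rw [← hσ.1, hzz, map_add, hσ.map_algebraMap]
  have hyz' : σ z * σ y = σ y * σ z := by rw [← hσ.1, ← hσ.1, hyz.eq]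
  -- a nonzero intertwiner of the two embeddings of the field generated by `y` and `z`
  obtain ⟨w₀, hw₀, hwy₀, hwz₀⟩ : ∃ w, w ≠ 0 ∧ w * σ y = y * w ∧ w * σ z = (z + 1) * w := by
    obtain ⟨t, ht⟩ : ∃ t, y * z * t + y * t * σ z + z * t * σ y + t * (σ z * σ y) ≠ 0 := by
      by_contra! hcon
      have h := eq_zero_of_sum_mul_mul hZ ![1, y, z, y * z] ![σ z * σ y, σ z, σ y, 1] hli
        (fun t => by
          rw [← hcon t]
          simp only [Fin.sum_univ_four, Matrix.cons_val, one_mul, mul_one]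
          abel)
      simpa using h 3
    refine ⟨_, ht, ?_, ?_⟩
    · have h1 : ∀ s, y * (y * s) = s * algebraMap F A β := fun s => by
        rw [← mul_assoc, hyy, Algebra.commutes]
      have h2 : ∀ s, y * (z * s) = z * (y * s) := fun s => by
        rw [← mul_assoc, hyz.eq, mul_assoc]
      have h3 : ∀ s, σ z * (σ y * s) = σ y * (σ z * s) := fun s => by
        rw [← mul_assoc, hyz', mul_assoc]
      have h4 : ∀ s, σ y * (σ y * s) = s * algebraMap F A β := fun s => by
        rw [← mul_assoc, hyy', Algebra.commutes]
      simp only [mul_add, add_mul, mul_assoc, h1, h2, h3, h4, hyy', hyz']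
      simp only [add_assoc, add_comm, add_left_comm]
    · have h1 : ∀ s, z * (z * s) = z * s + s * algebraMap F A γ := fun s => by
        rw [← mul_assoc, hzz, add_mul, Algebra.commutes]
      have h2 : ∀ s, y * (z * s) = z * (y * s) := fun s => by
        rw [← mul_assoc, hyz.eq, mul_assoc]
      have h3 : ∀ s, σ z * (σ y * s) = σ y * (σ z * s) := fun s => by
        rw [← mul_assoc, hyz', mul_assoc]
      simp only [mul_add, add_mul, mul_assoc, h1, h2, h3, hyz', hzz', one_mul]
      simp only [add_assoc, add_comm, add_left_comm, CharTwo.add_cancel_left,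
        CharTwo.add_self_eq_zero, add_zero]
  -- `σ w₀` is an intertwiner as well, so `w₀ + σ w₀` is a symmetric one unless `w₀` is symmetric
  obtain ⟨w, hw, hwσ, hwy, hwz⟩ :
      ∃ w, w ≠ 0 ∧ σ w = w ∧ w * σ y = y * w ∧ w * σ z = (z + 1) * w := by
    by_cases h0 : w₀ + σ w₀ = 0
    · exact ⟨w₀, hw₀, (CharTwo.add_eq_zero.mp h0).symm, hwy₀, hwz₀⟩
    · refine ⟨w₀ + σ w₀, h0, by rw [map_add, hσ.2, add_comm], ?_, ?_⟩
      · have h := congrArg σ hwy₀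
        rw [hσ.1, hσ.1, hσ.2] at h
        rw [add_mul, mul_add, hwy₀, h]
      · have h := congrArg σ hwz₀
        rw [hσ.1, hσ.1, hσ.2, map_add, hσ.map_one, mul_add, mul_one] at h
        rw [add_mul, hwz₀, mul_add, add_mul z 1 (σ w₀), h, one_mul, add_assoc (σ w₀ * σ z),
          CharTwo.add_self_eq_zero, add_zero]
  refine ⟨LinearMap.mulRight F w⁻¹ ∘ₗ LinearMap.mulLeft F w ∘ₗ σ, ⟨fun a b => ?_, fun a => ?_⟩,
    ?_, ?_⟩
  · simp only [LinearMap.comp_apply, LinearMap.mulLeft_apply, LinearMap.mulRight_apply, hσ.1]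
    simp only [mul_assoc, inv_mul_cancel_left₀ hw]
  · have h1 : σ w⁻¹ * w = 1 := by
      nth_rw 2 [← hwσ]
      rw [← hσ.1, mul_inv_cancel₀ hw, hσ.map_one]
    have h2 : σ w⁻¹ = w⁻¹ := eq_inv_of_mul_eq_one_left h1
    simp only [LinearMap.comp_apply, LinearMap.mulLeft_apply, LinearMap.mulRight_apply, hσ.1, hσ.2,
      h2, hwσ]
    simp only [mul_assoc, mul_inv_cancel₀ hw, mul_inv_cancel_left₀ hw, mul_one]
  · simp only [LinearMap.comp_apply, LinearMap.mulLeft_apply, LinearMap.mulRight_apply, hwy,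
      mul_inv_cancel_right₀ hw]
  · simp only [LinearMap.comp_apply, LinearMap.mulLeft_apply, LinearMap.mulRight_apply, hwz,
      mul_inv_cancel_right₀ hw]

/-- If `y, z` generate a field `L` of degree four, then the derivation of `L` with `y ↦ y`, `z ↦ 0` is
the commutator with some `x`, and `x² + x` lies in `F + F z`, the kernel of the derivation. The last
conjunct records that `L` is its own centralizer. -/
theorem exists_sq_add_self_mem (hA : finrank F A = 16)
    (hZ : ∀ w : A, (∀ t, Commute w t) → ∃ r : F, w = algebraMap F A r) {y z : A} {β e f : F}
    (hy : y ^ 2 = algebraMap F A β) (hz : z ^ 2 = algebraMap F A e * z + algebraMap F A f)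
    (hyz : Commute y z) (hli : LinearIndependent F ![1, y, z, y * z]) :
    ∃ x, Commute x z ∧ x * y + y * x = y ∧
      (∃ p q : F, x ^ 2 + x = algebraMap F A p + algebraMap F A q * z) ∧
      ∀ w, Commute w y → Commute w z → ∃ a b c d : F,
        w = (algebraMap F A a + algebraMap F A c * z)
          + (algebraMap F A b + algebraMap F A d * z) * y := by
  obtain ⟨t, htz, hty⟩ := exists_commute_not_commute hZ hz hli
  have hli' : LinearIndependent F ![1, z, y, z * y] := by
    convert hli.comp _ (Equiv.swap (1 : Fin 4) 2).injective using 1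
    funext i
    fin_cases i
    · rfl
    · rfl
    · rfl
    · exact hyz.eq.symm
  obtain ⟨v, hvy, hvz⟩ := exists_commute_not_commute (e := 0) hZ (by simpa using hy) hli'
  have hmem : ∀ w, Commute w y → Commute w z → _ :=
    fun w => eq_add_of_commute_commute hA hyz hli hty hvy hvz
  have hxy := mul_inv_mul_commutator hy hty
  set x := t * (t * y + y * t)⁻¹ * y with hx
  have hxz : Commute x z := (htz.mul_left
    ((htz.mul_left hyz).add_left (hyz.mul_left htz)).inv_left₀).mul_left hyz
  refine ⟨x, hxz, hxy, ?_, hmem⟩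
  obtain ⟨a, b, c, d, habcd⟩ := hmem _ (commute_sq_add_self hxy)
    ((hxz.pow_left 2).add_left hxz)
  have hp : Commute (algebraMap F A a + algebraMap F A c * z) x :=
    Commute.add_left (Algebra.commutes _ _) (Commute.mul_left (Algebra.commutes _ _) hxz.symm)
  have hq : Commute (algebraMap F A b + algebraMap F A d * z) x :=
    Commute.add_left (Algebra.commutes _ _) (Commute.mul_left (Algebra.commutes _ _) hxz.symm)
  have hy0 : y ≠ 0 := by
    rintro rfl
    exact hty (.zero_right _)
  -- `x² + x` commutes with `x`, so its component at `y` vanishes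
  have h0 : (algebraMap F A b + algebraMap F A d * z) * y = 0 := by
    have h1 : Commute (x ^ 2 + x) x := (Commute.pow_left rfl 2).add_left rfl
    rw [habcd] at h1
    have h2 := commute_iff_add_eq_zero.mp (h1.sub_left hp)
    rw [add_sub_cancel_left, mul_assoc, ← mul_assoc x, ← hq.eq, mul_assoc, ← mul_add,
      add_comm (y * x), hxy] at h2
    exact h2
  exact ⟨a, c, by rw [habcd, h0, add_zero]⟩

/-- Commuting square-central `y` and `u` generating a field of degree four admit an Artin–Schreier
partner `x` of `y` that commutes with `u`. -/
theorem exists_pair_of_sq (hA : finrank F A = 16)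
    (hZ : ∀ w : A, (∀ t, Commute w t) → ∃ r : F, w = algebraMap F A r) {y u : A} {β δ : F}
    (hy : y ^ 2 = algebraMap F A β) (hu : u ^ 2 = algebraMap F A δ)
    (hyu : Commute y u) (hli : LinearIndependent F ![1, y, u, y * u]) :
    ∃ x, Commute x u ∧ x * y + y * x = y ∧ ∃ α : F, x ^ 2 + x = algebraMap F A α := by
  obtain ⟨x, hxu, hxy, ⟨p, q, hpq⟩, -⟩ :=
    exists_sq_add_self_mem (e := 0) hA hZ hy (by simpa using hu) hyu hli
  refine ⟨x + q • u, hxu.add_left (.smul_left rfl q), ?_, p + q * q * δ, ?_⟩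
  · rw [add_mul, mul_add, add_add_add_comm, hxy, (hyu.smul_right q).eq, CharTwo.add_self_eq_zero,
      add_zero]
  · have e : (x + q • u) ^ 2 + (x + q • u) = (x ^ 2 + x) + (q * q) • u ^ 2 + q • u := by
      simp only [pow_two, mul_add, add_mul, smul_mul_assoc, mul_smul_comm, smul_smul, smul_add,
        hxu.eq]
      simp only [add_assoc, add_comm, add_left_comm, CharTwo.add_cancel_left,
        CharTwo.add_self_eq_zero, add_zero]
    rw [e, hpq, hu, ← Algebra.smul_def, map_add, map_mul _ (q * q), Algebra.smul_def (q * q)]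
    simp only [add_assoc, add_comm, add_left_comm, CharTwo.add_cancel_left,
      CharTwo.add_self_eq_zero, add_zero]

/-- Square-central `y` and commuting Artin–Schreier `z` generating a field of degree four admit an
Artin–Schreier partner `x` of `y` that commutes with `z`. The involution of the algebra exhibits `[q, β)` as split, where `x² + x = p + q z`, and thus allows `x`
to be corrected. -/
theorem exists_pair_of_sq_add_self (hA : finrank F A = 16)
    (hZ : ∀ w : A, (∀ t, Commute w t) → ∃ r : F, w = algebraMap F A r) {σ : A →ₗ[F] A}
    (hσ : IsLinearInvolution σ) {y z : A} {β γ : F}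
    (hy : y ^ 2 = algebraMap F A β) (hz : z ^ 2 + z = algebraMap F A γ)
    (hyz : Commute y z) (hli : LinearIndependent F ![1, y, z, y * z]) :
    ∃ x, Commute x z ∧ x * y + y * x = y ∧ ∃ α : F, x ^ 2 + x = algebraMap F A α := by
  obtain ⟨τ, hτ, hτy, hτz⟩ := exists_isLinearInvolution_map_eq hZ hσ hy hz hyz hli
  have hz2 : z ^ 2 = z + algebraMap F A γ := by
    rw [← hz, add_comm (z ^ 2), CharTwo.add_cancel_left]
  obtain ⟨x, hxz, hxy, ⟨p, q, hpq⟩, hmem⟩ :=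
    exists_sq_add_self_mem (e := 1) hA hZ hy (by simpa using hz2) hyz hli
  obtain ⟨a, b, c, d, habcd⟩ := hmem (τ x + x) (by
      have h := congrArg τ hxy
      rw [map_add, hτ.1, hτ.1, hτy] at h
      rw [commute_iff_add_eq_zero, add_mul, mul_add, add_add_add_comm, hxy, add_comm (τ x * y), h,
        CharTwo.add_self_eq_zero]) (by
      have h := congrArg τ hxz.eq
      rw [hτ.1, hτ.1, hτz, add_mul, mul_add, one_mul, mul_one] at h
      exact Commute.add_left (add_right_cancel h).symm hxz)
  -- `τ x + x` is fixed by `τ`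
  have hcd : c = 0 ∧ d = 0 := by
    have h1 : τ (τ x + x) = τ x + x := by rw [map_add, hτ.2, add_comm]
    rw [habcd] at h1
    simp only [map_add, hτ.1, hτz, hτy, hτ.map_algebraMap] at h1
    have h2 : algebraMap F A c + algebraMap F A d * y = 0 := by
      rw [← CharTwo.add_eq_zero] at h1
      rw [← h1]
      simp only [← Algebra.smul_def, Algebra.algebraMap_eq_smul_one, mul_add, add_mul,
        mul_smul_comm, smul_mul_assoc, mul_one, one_mul, smul_add, hyz.eq]
      simp only [add_assoc, add_comm, add_left_comm, CharTwo.add_cancel_left,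
        CharTwo.add_self_eq_zero, add_zero]
    have h3 := Fintype.linearIndependent_iff.mp hli ![c, d, 0, 0] (by
      simpa [Fin.sum_univ_four, Algebra.smul_def] using h2)
    exact ⟨h3 0, h3 1⟩
  have hτx : τ x = x + (a • 1 + b • y) := by
    rw [hcd.1, hcd.2] at habcd
    simp only [map_zero, zero_mul, add_zero, ← Algebra.smul_def,
      Algebra.algebraMap_eq_smul_one, smul_mul_assoc, one_mul] at habcd
    rw [← habcd, add_comm, add_assoc, CharTwo.add_self_eq_zero, add_zero]
  have hyx : y * x = y + x * y := CharTwo.add_eq_iff_eq_add.mp ((add_comm _ _).trans hxy)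
  have hyx' : ∀ s, y * (x * s) = y * s + x * (y * s) := fun s => by
    rw [← mul_assoc, hyx, add_mul, mul_assoc]
  have hyy : y * y = β • (1 : A) := by rw [← pow_two, hy, Algebra.algebraMap_eq_smul_one]
  have hzz : z * z = z + γ • (1 : A) := by rw [← pow_two, hz2, Algebra.algebraMap_eq_smul_one]
  have hxx : x * x = x + (p • (1 : A) + q • z) := by
    rw [Algebra.smul_def q, ← Algebra.algebraMap_eq_smul_one, ← hpq, pow_two, add_comm (x * x),
      CharTwo.add_cancel_left]
  -- apply `τ` to `x² + x = p + q z`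
  have hq : q • (1 : A) = (a * a + a + b * b * β) • (1 : A) := by
    have h1 := congrArg τ hxx
    rw [hτ.1] at h1
    simp only [map_add, map_smul, hτz, hτ.map_one, hτx] at h1
    rw [← CharTwo.add_eq_zero] at h1 ⊢
    rw [← h1]
    simp only [mul_add, add_mul, smul_mul_assoc, mul_smul_comm, smul_smul, smul_add, mul_one,
      one_mul, hxx, hyx, hyy, add_smul, mul_comm b a,
      mul_assoc b b β]
    simp only [add_assoc, add_comm, add_left_comm, CharTwo.add_cancel_left,
      CharTwo.add_self_eq_zero, add_zero]
  have hyz' : ∀ s, y * (z * s) = z * (y * s) := fun s => by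
    rw [← mul_assoc, hyz.eq, mul_assoc]
  have hxz' : ∀ s, x * (z * s) = z * (x * s) := fun s => by
    rw [← mul_assoc, hxz.eq, mul_assoc]
  have hzz' : ∀ s, z * (z * s) = z * s + γ • s := fun s => by
    rw [← mul_assoc, hzz, add_mul, smul_mul_assoc, one_mul]
  refine ⟨x + (a • z + b • (z * y)), ?_, ?_, p + (a * a + b * b * β) * γ, ?_⟩
  · exact hxz.add_left ((Commute.smul_left rfl a).add_left
      ((Commute.mul_left rfl hyz).smul_left b))
  · simp only [mul_add, add_mul, smul_mul_assoc, mul_smul_comm, mul_assoc, hyz.eq, hyz', hyx]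
    simp only [add_assoc, add_comm, add_left_comm, CharTwo.add_cancel_left,
      CharTwo.add_self_eq_zero, add_zero]
  · have hqz : q • z = (a * a + a + b * b * β) • z := by
      rw [← one_mul z, ← smul_mul_assoc, hq, smul_mul_assoc]
    rw [← CharTwo.add_eq_zero, pow_two, Algebra.algebraMap_eq_smul_one]
    simp only [mul_add, add_mul, smul_mul_assoc, mul_smul_comm, smul_smul, smul_add, mul_one,
      one_mul, mul_assoc, hxx, hyx, hyx', hyy, hyz.eq, hyz', hxz.eq, hxz', hzz, hzz', hqz, add_smul,
      mul_comm b a]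
    simp only [mul_comm, mul_left_comm, add_assoc, add_comm, add_left_comm,
      CharTwo.add_cancel_left, CharTwo.add_self_eq_zero, add_zero]

end Extension

/-! ### Chains of quadruples -/

section Chain

set_option linter.unusedSimpArgs false

variable {F A : Type*} [Field F] [DivisionRing A] [Algebra F A]

theorem GenQuadruple.y_ne_zero (p : GenQuadruple F A) : p.y ≠ 0 := by
  obtain ⟨β, hβ, h⟩ := p.y_sq
  intro h0
  rw [h0, zero_pow two_ne_zero, eq_comm, map_eq_zero] at h
  exact hβ h

theorem GenQuadruple.exists_y_sq (p : GenQuadruple F A) : ∃ β : F, p.y ^ 2 = algebraMap F A β :=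
  let ⟨β, _, h⟩ := p.y_sq
  ⟨β, h⟩

theorem Quadruple.mk_swap (p : GenQuadruple F A) : Quadruple.mk p.swap = Quadruple.mk p :=
  Quotient.sound (Or.inr rfl)

theorem Quadruple.exists_connectedInSteps {p r₁ r₂ q : GenQuadruple F A}
    (h₁ : Quadruple.LambdaThree (.mk p) (.mk r₁)) (h₂ : Quadruple.LambdaThree (.mk r₁) (.mk r₂))
    (h₃ : Quadruple.LambdaThree (.mk r₂) (.mk q)) :
    ∃ n : ℕ, n ≤ 3 ∧ Quadruple.ConnectedInSteps n (.mk p) (.mk q) := by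
  refine ⟨3, le_rfl, ![.mk p, .mk r₁, .mk r₂, .mk q], rfl, rfl, fun i => ?_⟩
  fin_cases i <;> assumption

variable [CharP A 2]

theorem GenQuadruple.not_commute (p : GenQuadruple F A) : ¬ Commute p.x p.y :=
  not_commute_of_commutator p.y_ne_zero p.xy

theorem exists_algebraMap_of_forall_commute (hA : finrank F A = 16) (p : GenQuadruple F A) (w : A)
    (hw : ∀ t, Commute w t) : ∃ r : F, w = algebraMap F A r :=
  exists_algebraMap_of_commute hA p.not_commute p.swap.not_commute p.xz p.xu p.yz p.yu
    (hw _) (hw _) (hw _) (hw _)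

theorem exists_genQuadruple_y_z (hA : finrank F A = 16)
    (hZ : ∀ w : A, (∀ t, Commute w t) → ∃ r : F, w = algebraMap F A r) {σ : A →ₗ[F] A}
    (hσ : IsLinearInvolution σ) {y z : A} (hy : ∃ β : F, y ^ 2 = algebraMap F A β)
    (hz : ∃ γ : F, z ^ 2 + z = algebraMap F A γ) (hyz : Commute y z)
    (hzF : ∀ r : F, z ≠ algebraMap F A r)
    (hyF : ∀ p q : F, y ≠ algebraMap F A p + algebraMap F A q * z) :
    ∃ R : GenQuadruple F A, R.y = y ∧ R.z = z := by
  obtain ⟨β, hβ⟩ := hy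
  obtain ⟨γ, hγ⟩ := hz
  have hz2 : z ^ 2 = algebraMap F A 1 * z + algebraMap F A γ := by
    rw [← hγ, add_comm (z ^ 2), map_one, one_mul, CharTwo.add_cancel_left]
  obtain ⟨x, hxz, hxy, hx⟩ := exists_pair_of_sq_add_self hA hZ hσ hβ hγ hyz
    (linearIndependent_of_quadratic hz2 hyz hzF hyF)
  obtain ⟨R, -, h2, h3⟩ := exists_genQuadruple_of_sq_add_self hA hZ hx
    (fun h => hyF 0 0 (by simp [h])) ⟨β, hβ⟩ hxy hxz.symm hyz.symm hzF ⟨γ, hγ⟩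
  exact ⟨R, h2, h3⟩

theorem exists_genQuadruple_y_u (hA : finrank F A = 16)
    (hZ : ∀ w : A, (∀ t, Commute w t) → ∃ r : F, w = algebraMap F A r) {y u : A}
    (hy : ∃ β : F, y ^ 2 = algebraMap F A β) (hu : ∃ δ : F, u ^ 2 = algebraMap F A δ)
    (hyu : Commute y u) (huF : ∀ r : F, u ≠ algebraMap F A r)
    (hyF : ∀ p q : F, y ≠ algebraMap F A p + algebraMap F A q * u) :
    ∃ R : GenQuadruple F A, R.y = y ∧ R.u = u := by
  obtain ⟨β, hβ⟩ := hy
  obtain ⟨δ, hδ⟩ := hu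
  obtain ⟨x, hxu, hxy, hx⟩ := exists_pair_of_sq hA hZ hβ hδ hyu
    (linearIndependent_of_quadratic (e := 0) (by simpa using hδ) hyu huF hyF)
  obtain ⟨R, -, h2, h3⟩ := exists_genQuadruple_of_sq hA hZ hx
    (fun h => hyF 0 0 (by simp [h])) ⟨β, hβ⟩ hxy hxu.symm hyu.symm huF ⟨δ, hδ⟩
  exact ⟨R, h2, h3⟩

/-- Two noncommuting square-central elements whose anticommutator is a scalar generate a quaternion
algebra, and an Artin–Schreier element forms a pair of generators with either of them. -/
theorem exists_common_x {y y' : A} {β β' r : F} (hy : y ^ 2 = algebraMap F A β)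
    (hy' : y' ^ 2 = algebraMap F A β') (hr : r ≠ 0) (hs : y * y' + y' * y = algebraMap F A r) :
    ∃ x, (∃ α : F, x ^ 2 + x = algebraMap F A α) ∧ x * y + y * x = y ∧ x * y' + y' * x = y' := by
  rw [Algebra.algebraMap_eq_smul_one] at hs hy hy'
  rw [pow_two] at hy hy'
  have hyy : ∀ s, y * (y * s) = β • s := fun s => by
    rw [← mul_assoc, hy, smul_mul_assoc, one_mul]
  have hsw : y' * y = r • (1 : A) + y * y' := by
    rw [← hs, add_comm, CharTwo.add_cancel_left]
  have hsw' : ∀ s, y' * (y * s) = r • s + y * (y' * s) := fun s => by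
    rw [← mul_assoc, hsw, add_mul, smul_mul_assoc, one_mul, mul_assoc]
  refine ⟨r⁻¹ • (y * y'), ⟨r⁻¹ * r⁻¹ * β * β', ?_⟩, ?_, ?_⟩
  · rw [Algebra.algebraMap_eq_smul_one]
    simp only [pow_two, smul_mul_assoc, mul_smul_comm, mul_assoc, hsw, hsw', hy, hy', hyy,
      mul_add, smul_add, smul_smul, mul_one, inv_mul_cancel₀ hr]
    rw [add_right_comm, CharTwo.add_self_eq_zero, zero_add, mul_comm β' β]
  · simp only [smul_mul_assoc, mul_smul_comm, mul_assoc, hsw, hyy, mul_add, smul_add, smul_smul,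
      mul_one, inv_mul_cancel₀ hr, one_smul]
    rw [add_assoc, CharTwo.add_self_eq_zero, add_zero]
  · simp only [smul_mul_assoc, mul_smul_comm, mul_assoc, hsw', hy', mul_add, smul_add, smul_smul,
      mul_one, inv_mul_cancel₀ hr, one_smul]
    rw [add_comm, add_assoc, CharTwo.add_self_eq_zero, add_zero]

end Chain

theorem mainTheorem1 (F : Type*) [Field F] [CharP F 2] (A : Type*) [DivisionRing A] [Algebra F A]
    (hA : IsBiquaternionAlgebra F A) (P Q : Quadruple F A) :
    ∃ n : ℕ, n ≤ 3 ∧ Quadruple.ConnectedInSteps n P Q := by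
  have : CharP A 2 := charP_of_injective_algebraMap (algebraMap F A).injective 2
  obtain ⟨σ, hσ⟩ := hA.exists_isLinearInvolution
  replace hA := hA.finrank_eq
  induction P using Quotient.inductionOn with | _ p
  induction Q using Quotient.inductionOn with | _ q
  change ∃ n : ℕ, n ≤ 3 ∧ Quadruple.ConnectedInSteps n (.mk p) (.mk q)
  have hZ := exists_algebraMap_of_forall_commute hA p
  have hpy := p.exists_y_sq
  have hqy := q.exists_y_sq
  by_cases hcomm : Commute p.y q.y
  · have hqF : ∀ r : F, q.y ≠ algebraMap F A r := fun r h =>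
      q.not_commute (h ▸ (Algebra.commutes r q.x).symm)
    have hpF : ∀ r : F, p.y ≠ algebraMap F A r := fun r h =>
      p.not_commute (h ▸ (Algebra.commutes r p.x).symm)
    by_cases hF : ∃ a b : F, p.y = algebraMap F A a + algebraMap F A b * q.y
    · -- `p.y` centralizes the quaternion algebra generated by `q.z` and `q.u`
      obtain ⟨a, b, hab⟩ := hF
      have hc : ∀ c, Commute q.y c → Commute p.y c := fun c hc => by
        rw [hab]
        exact Commute.add_left (Algebra.commutes _ _) (Commute.mul_left (Algebra.commutes _ _) hc)
      obtain ⟨R, h1, -, h3⟩ := exists_genQuadruple_of_sq hA hZ q.z_artinSchreier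
        q.swap.y_ne_zero q.swap.exists_y_sq q.zu (hc _ q.yz) (hc _ q.yu) hpF hpy
      exact Quadruple.exists_connectedInSteps (r₁ := R) (r₂ := R)
        ⟨p, R.swap, rfl, Quadruple.mk_swap R, .inr (.inl h3.symm)⟩
        ⟨R, R, rfl, rfl, .inl rfl⟩
        ⟨R, q.swap, rfl, Quadruple.mk_swap q, .inl h1⟩
    · push Not at hF
      obtain ⟨R, h1, h2⟩ := exists_genQuadruple_y_u hA hZ hpy hqy hcomm hqF hF
      exact Quadruple.exists_connectedInSteps (r₁ := R) (r₂ := R)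
        ⟨p, R, rfl, rfl, .inr (.inl h1.symm)⟩
        ⟨R, R, rfl, rfl, .inl rfl⟩
        ⟨R.swap, q, Quadruple.mk_swap R, rfl, .inr (.inl h2)⟩
  · obtain ⟨β, hβ⟩ := hpy
    obtain ⟨β', hβ'⟩ := hqy
    by_cases hs : ∃ r : F, p.y * q.y + q.y * p.y = algebraMap F A r
    · obtain ⟨r, hr⟩ := hs
      have hr0 : r ≠ 0 := by
        rintro rfl
        exact hcomm (commute_iff_add_eq_zero.mpr (hr.trans (map_zero _)))
      obtain ⟨x, hx, hxp, hxq⟩ := exists_common_x hβ hβ' hr0 hr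
      obtain ⟨R₁, h1, h2⟩ := exists_genQuadruple_of_pair hA hZ hx p.y_ne_zero ⟨β, hβ⟩ hxp
        p.yz.symm p.yu.symm p.swap.not_commute
      obtain ⟨R₂, h3, h4⟩ := exists_genQuadruple_of_pair hA hZ hx q.y_ne_zero ⟨β', hβ'⟩ hxq
        q.yz.symm q.yu.symm q.swap.not_commute
      exact Quadruple.exists_connectedInSteps (r₁ := R₁) (r₂ := R₂)
        ⟨p, R₁, rfl, rfl, .inr (.inl h2.symm)⟩
        ⟨R₁, R₂, rfl, rfl, .inl (h1.trans h3.symm)⟩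
        ⟨R₂, q, rfl, rfl, .inr (.inl h4)⟩
    · push Not at hs
      have hanti : ∀ {a b : A} {c : F}, a ^ 2 = algebraMap F A c →
          Commute (a * b + b * a) a := by
        intro a b c hc
        have h : ∀ s, a * (a * s) = s * (a * a) := fun s => by
          rw [← mul_assoc, ← pow_two, hc, Algebra.commutes]
        rw [commute_iff_eq]
        simp only [mul_add, add_mul, mul_assoc, h, add_comm]
      set s := p.y * q.y + q.y * p.y with hsdef
      have hsp : Commute s p.y := hanti hβ
      have hsq : Commute s q.y := by
        rw [hsdef, add_comm]
        exact hanti hβ'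
      obtain ⟨t, ht⟩ : ∃ t, ¬ Commute s t := by
        by_contra! h
        obtain ⟨r, hr⟩ := hZ s h
        exact hs r hr
      obtain ⟨a, b, hab⟩ := exists_sq_eq_of_commute hA hcomm hsp hsq ht
      obtain ⟨r, hr, h⟩ := exists_smul_normalized hab
      have hwF : ∀ c : F, r • s ≠ algebraMap F A c := by
        intro c hc
        apply hs (r⁻¹ * c)
        rw [map_mul, ← hc, ← Algebra.smul_def, smul_smul, inv_mul_cancel₀ hr, one_smul]
      have hwp : Commute p.y (r • s) := hsp.symm.smul_right r
      have hwq : Commute q.y (r • s) := hsq.symm.smul_right r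
      have hpw : ∀ c d : F, p.y ≠ algebraMap F A c + algebraMap F A d * (r • s) := by
        intro c d h
        apply hcomm
        rw [h]
        exact Commute.add_left (Algebra.commutes _ _)
          (Commute.mul_left (Algebra.commutes _ _) hwq.symm)
      have hqw : ∀ c d : F, q.y ≠ algebraMap F A c + algebraMap F A d * (r • s) := by
        intro c d h
        apply hcomm
        rw [h]
        exact Commute.add_right (Algebra.commutes _ _).symm
          (Commute.mul_right (Algebra.commutes _ _).symm hwp)
      rcases h with h | h
      · obtain ⟨R₁, h1, h2⟩ := exists_genQuadruple_y_z hA hZ hσ ⟨β, hβ⟩ h hwp hwF hpw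
        obtain ⟨R₂, h3, h4⟩ := exists_genQuadruple_y_z hA hZ hσ ⟨β', hβ'⟩ h hwq hwF hqw
        exact Quadruple.exists_connectedInSteps (r₁ := R₁) (r₂ := R₂)
          ⟨p, R₁, rfl, rfl, .inr (.inl h1.symm)⟩
          ⟨R₁, R₂, rfl, rfl, .inr (.inr (.inl (h2.trans h4.symm)))⟩
          ⟨R₂, q, rfl, rfl, .inr (.inl h3)⟩
      · obtain ⟨R₁, h1, h2⟩ := exists_genQuadruple_y_u hA hZ ⟨β, hβ⟩ h hwp hwF hpw
        obtain ⟨R₂, h3, h4⟩ := exists_genQuadruple_y_u hA hZ ⟨β', hβ'⟩ h hwq hwF hqw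
        exact Quadruple.exists_connectedInSteps (r₁ := R₁) (r₂ := R₂)
          ⟨p, R₁, rfl, rfl, .inr (.inl h1.symm)⟩
          ⟨R₁, R₂, rfl, rfl, .inr (.inr (.inr (h2.trans h4.symm)))⟩
          ⟨R₂, q, rfl, rfl, .inr (.inl h3)⟩
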